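/- Let $M$ be a smooth (Hausdorff) manifold of even dimension $2m$. Let $\pi: J(M)\to M$ be the bundle whose fibre over $x$ is $\{\,j\in \operatorname{End}(T_xM) : j^2=-\mathrm{id}\,\}$, regarded as a submanifold of the total space of $\operatorname{End}(TM)$, and let $\mathcal{J}$ be the tautological section of $\operatorname{End}(\pi^*TM)$ over $J(M)$, whose value at $j$ is $j$ itself. For a smooth connection $\nabla$ on $TM$, let $\pi^*\nabla$ be the pulled-back connection on $\pi^*TM$ (and on $\operatorname{End}(\pi^*TM)$), and let $J^\nabla$ be the almost complex structure on $J(M)$ that is uniquely determined by $$d\pi(J^\nabla X)=\mathcal{J}\,d\pi(X),\qquad (\pi^*\nabla)_{J^\nabla X}\mathcal{J}=\mathcal{J}\circ(\pi^*\nabla)_X\mathcal{J}$$ for all tangent vectors $X$ of $J(M)$. Two smooth connections $\nabla,\nabla'$ on $TM$ are called projectively equivalent (belong to the same projective class) if there is a smooth $1$-form $\alpha$ on $M$ with $$\nabla'_XY=\nabla_XY+\alpha(X)Y+\alpha(Y)X$$ for all vector fields $X,Y$. Theorem. Let $\nabla,\nabla'$ be smooth connections on $TM$. 1. (Torsion allowed.)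 If $\nabla$ and $\nabla'$ are projectively equivalent, then $J^\nabla=J^{\nabla'}$; that is, $J^\nabla$ depends only on the projective class of $\nabla$. 2. If $\nabla$ and $\nabla'$ are both torsion-free, then $J^\nabla=J^{\nabla'}$ if and only if $\nabla$ and $\nabla'$ are projectively equivalent. -/

import Mathlib

set_option linter.unusedSectionVars false

open Bundle FiberBundle
open scoped Manifold ContDiff Topology

namespace Twistor

variable {E : Type*} [NormedAddCommGroup E] [NormedSpace ℝ E]
  {M : Type*} [TopologicalSpace M] [ChartedSpace E M] [IsManifold 𝓘(ℝ, E) ∞ M]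

variable (E M) in
/-- The total space of the bundle `End TM` over the manifold `M` modelled on `E`. -/
abbrev EndBundle : Type _ :=
  TotalSpace (E →L[ℝ] E)
    (fun x : M => TangentSpace 𝓘(ℝ, E) x →L[ℝ] TangentSpace 𝓘(ℝ, E) x)

variable (E M) in
/-- The bundle `J(M)` of all endomorphisms `j` of tangent spaces of `M` with `j² = -1`, as a
(fibre-wise) submanifold of the total space of `End TM`. A point `p` consists of its base point
`p.1 = π(p)` in `M` and of the endomorphism `p.2` of the tangent space of `M` at `p.1`. -/
def twistorSpace : Set (EndBundle E M) :=
  {p | p.2 ∘L p.2 = -ContinuousLinearMap.id ℝ (TangentSpace 𝓘(ℝ, E) p.1)}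

/-- The model with corners of the total space of `End TM`. -/
noncomputable abbrev EndModel (E : Type*) [NormedAddCommGroup E] [NormedSpace ℝ E] :=
  𝓘(ℝ, E).prod 𝓘(ℝ, E →L[ℝ] E)

/-- `X` is the velocity at time `0` of a smooth curve that stays in `J(M)` and is at `p` at
time `0`. -/
def IsTangent (p : EndBundle E M) (X : TangentSpace (EndModel E) p) : Prop :=
  ∃ γ : ℝ → EndBundle E M, ContMDiffAt 𝓘(ℝ, ℝ) (EndModel E) ∞ γ 0 ∧
      (∀ᶠ t in 𝓝 (0 : ℝ), γ t ∈ twistorSpace E M) ∧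
      tangentMap 𝓘(ℝ, ℝ) (EndModel E) γ ⟨0, (1 : ℝ)⟩ = ⟨p, X⟩

/-- The fibre coordinate of `q` in the trivialization of `End TM` around the base point of `p`. -/
noncomputable def coord (p q : EndBundle E M) : E →L[ℝ] E :=
  (trivializationAt (E →L[ℝ] E)
    (fun x : M => TangentSpace 𝓘(ℝ, E) x →L[ℝ] TangentSpace 𝓘(ℝ, E) x) p.1 q).2

lemma hasMFDerivAt_extChartAt_self (p : EndBundle E M) :
    HasMFDerivAt (EndModel E) 𝓘(ℝ, E × (E →L[ℝ] E)) (extChartAt (EndModel E) p) p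
      (ContinuousLinearMap.id ℝ (E × (E →L[ℝ] E))) := by
  have h2 : MDifferentiableAt (EndModel E) 𝓘(ℝ, E × (E →L[ℝ] E)) (extChartAt (EndModel E) p) p :=
    mdifferentiableAt_extChartAt (mem_chart_source (ModelProd E (E →L[ℝ] E)) p)
  have := h2.hasMFDerivAt
  rwa [mfderiv_extChartAt_self] at this

lemma extChartAt_apply (p q : EndBundle E M) :
    extChartAt (EndModel E) p q = (extChartAt 𝓘(ℝ, E) p.1 q.1, coord p q) := by
  rw [FiberBundle.extChartAt]
  rfl

lemma eventually_source (p : EndBundle E M) : ∀ᶠ q in 𝓝 p, q.1 ∈ (chartAt E p.1).source := by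
  have : Filter.Tendsto (fun q : EndBundle E M => q.1) (𝓝 p) (𝓝 p.1) :=
    (FiberBundle.continuous_proj (E →L[ℝ] E) _).continuousAt
  exact this ((chartAt E p.1).open_source.mem_nhds (mem_chart_source E p.1))

lemma hasMFDerivAt_proj (p : EndBundle E M) :
    HasMFDerivAt (EndModel E) 𝓘(ℝ, E) (fun q : EndBundle E M => q.1) p
      (ContinuousLinearMap.fst ℝ E (E →L[ℝ] E)) := by
  have h : MDifferentiableAt (EndModel E) 𝓘(ℝ, E) (fun q : EndBundle E M => q.1) p :=
    Bundle.mdifferentiableAt_proj _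
  have h1 : MDifferentiableAt 𝓘(ℝ, E) 𝓘(ℝ, E) (extChartAt 𝓘(ℝ, E) p.1) p.1 :=
    mdifferentiableAt_extChartAt (mem_chart_source E p.1)
  have h1' := h1.hasMFDerivAt
  rw [mfderiv_extChartAt_self] at h1'
  have h3 := h1'.comp p h.hasMFDerivAt
  have h4 := (ContinuousLinearMap.fst ℝ E (E →L[ℝ] E)).hasMFDerivAt.comp p
    (hasMFDerivAt_extChartAt_self p)
  have h5 : (extChartAt 𝓘(ℝ, E) p.1 ∘ (fun q : EndBundle E M => q.1)) =ᶠ[𝓝 p]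
      (ContinuousLinearMap.fst ℝ E (E →L[ℝ] E)) ∘ (extChartAt (EndModel E) p) := by
    refine Filter.Eventually.of_forall fun q => ?_
    rw [Function.comp_apply, Function.comp_apply, extChartAt_apply p q]
    rfl
  have h6 := hasMFDerivAt_unique h3 (h4.congr_of_eventuallyEq h5)
  have h7 := h.hasMFDerivAt
  have h8 : mfderiv (EndModel E) 𝓘(ℝ, E) (fun q : EndBundle E M => q.1) p =
    ContinuousLinearMap.fst ℝ E (E →L[ℝ] E) := h6
  rwa [h8] at h7

lemma hasMFDerivAt_coord (p : EndBundle E M) :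
    HasMFDerivAt (EndModel E) 𝓘(ℝ, E →L[ℝ] E) (coord p) p
      (ContinuousLinearMap.snd ℝ E (E →L[ℝ] E)) := by
  have h4 := (ContinuousLinearMap.snd ℝ E (E →L[ℝ] E)).hasMFDerivAt.comp p
    (hasMFDerivAt_extChartAt_self p)
  refine h4.congr_of_eventuallyEq (Filter.Eventually.of_forall fun q => ?_)
  rw [Function.comp_apply, extChartAt_apply p q]
  rfl

lemma symmL_self (x : M)  :
    (trivializationAt E (TangentSpace 𝓘(ℝ, E)) x).symmL ℝ x = ContinuousLinearMap.id ℝ E := by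
  rw [TangentBundle.symmL_trivializationAt_eq_core (mem_chart_source E x)]
  ext v
  exact (tangentBundleCore 𝓘(ℝ, E) M).coordChange_self (achart E x) x (mem_chart_source E x) v

lemma clmAt_self (x : M)  :
    (trivializationAt E (TangentSpace 𝓘(ℝ, E)) x).continuousLinearMapAt ℝ x
      = ContinuousLinearMap.id ℝ E := by
  rw [TangentBundle.continuousLinearMapAt_trivializationAt_eq_core (mem_chart_source E x)]
  ext v
  exact (tangentBundleCore 𝓘(ℝ, E) M).coordChange_self (achart E x) x (mem_chart_source E x) v

lemma triv_self (x : M) (v : TangentSpace 𝓘(ℝ, E) x) :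
    (trivializationAt E (TangentSpace 𝓘(ℝ, E)) x ⟨x, v⟩).2 = v := by
  have := congrArg (fun f : E →L[ℝ] E => f v) (clmAt_self (E := E) x)
  rw [← Trivialization.continuousLinearMapAt_apply_of_mem (R := ℝ)]
  · exact this
  · exact mem_chart_source E x

lemma coord_apply (p q : EndBundle E M) (w : E) :
    coord p q w = (trivializationAt E (TangentSpace 𝓘(ℝ, E)) p.1).continuousLinearMapAt ℝ q.1
      (q.2 ((trivializationAt E (TangentSpace 𝓘(ℝ, E)) p.1).symmL ℝ q.1 w)) := by
  rfl

lemma coord_self (p : EndBundle E M) : coord p p = p.2 := by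
  ext w
  rw [coord_apply, symmL_self, clmAt_self]
  rfl

lemma clmAt_symmL {x y : M} (hy : y ∈ (chartAt E x).source) (w : E) :
    (trivializationAt E (TangentSpace 𝓘(ℝ, E)) x).continuousLinearMapAt ℝ y
      ((trivializationAt E (TangentSpace 𝓘(ℝ, E)) x).symmL ℝ y w) = w :=
  Trivialization.continuousLinearMapAt_symmL _ hy w

lemma symmL_clmAt {x y : M} (hy : y ∈ (chartAt E x).source) (v : TangentSpace 𝓘(ℝ, E) y) :
    (trivializationAt E (TangentSpace 𝓘(ℝ, E)) x).symmL ℝ y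
      ((trivializationAt E (TangentSpace 𝓘(ℝ, E)) x).continuousLinearMapAt ℝ y v) = v :=
  Trivialization.symmL_continuousLinearMapAt _ hy v

lemma mem_twistorSpace {q : EndBundle E M} :
    q ∈ twistorSpace E M ↔ ∀ v, q.2 (q.2 v) = -v :=
  ⟨fun h v => congrArg (fun f : TangentSpace 𝓘(ℝ, E) q.1 →L[ℝ] TangentSpace 𝓘(ℝ, E) q.1 => f v) h,
    fun h => ContinuousLinearMap.ext h⟩

lemma mem_twistorSpace_iff_coord {p q : EndBundle E M} (h : q.1 ∈ (chartAt E p.1).source) :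
    q ∈ twistorSpace E M ↔ coord p q * coord p q = - 1 := by
  have key : ∀ w, (coord p q * coord p q) w =
      (trivializationAt E (TangentSpace 𝓘(ℝ, E)) p.1).continuousLinearMapAt ℝ q.1
      (q.2 (q.2 ((trivializationAt E (TangentSpace 𝓘(ℝ, E)) p.1).symmL ℝ q.1 w))) := by
    intro w
    change coord p q (coord p q w) = _
    rw [coord_apply, coord_apply, symmL_clmAt h]
  rw [mem_twistorSpace]
  constructor
  · intro hq
    refine ContinuousLinearMap.ext fun w => ?_
    rw [key, hq, map_neg, clmAt_symmL h]
    rfl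
  · intro hq v
    have := key ((trivializationAt E (TangentSpace 𝓘(ℝ, E)) p.1).continuousLinearMapAt ℝ q.1 v)
    rw [hq, symmL_clmAt h] at this
    have h2 := congrArg ((trivializationAt E (TangentSpace 𝓘(ℝ, E)) p.1).symmL ℝ q.1) this
    rw [symmL_clmAt h] at h2
    rw [← h2]
    refine (map_neg ((trivializationAt E (TangentSpace 𝓘(ℝ, E)) p.1).symmL ℝ q.1) _).trans ?_
    exact congrArg _ (symmL_clmAt h v)

lemma extend_eq {x y : M} (hy : y ∈ (chartAt E x).source) (v : E) :
    extend E (x := x) (E := TangentSpace 𝓘(ℝ, E)) v y =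
    (trivializationAt E (TangentSpace 𝓘(ℝ, E)) x).symmL ℝ y v := by
  have : extend E (x := x) (E := TangentSpace 𝓘(ℝ, E)) v y =
    (trivializationAt E (TangentSpace 𝓘(ℝ, E)) x).symm y
      (trivializationAt E (TangentSpace 𝓘(ℝ, E)) x ⟨x, v⟩).2 := rfl
  refine this.trans ((Trivialization.symmL_apply (R := ℝ) _ hy _).symm.trans ?_)
  exact congrArg ((trivializationAt E (TangentSpace 𝓘(ℝ, E)) x).symmL ℝ y) (triv_self x v)

/-- Connections in the tangent bundle `TM`; `cov Y x v` is `(∇_v Y)(x)`. -/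
abbrev Connection (E M : Type*) [NormedAddCommGroup E] [NormedSpace ℝ E]
    [TopologicalSpace M] [ChartedSpace E M] [IsManifold 𝓘(ℝ, E) ∞ M] :=
  CovariantDerivative 𝓘(ℝ, E) E (TangentSpace 𝓘(ℝ, E) : M → Type _)

section pullback
variable {F : Type*} [NormedAddCommGroup F] [NormedSpace ℝ F] {H : Type*} [TopologicalSpace H]
  (I : ModelWithCorners ℝ F H) {N : Type*} [TopologicalSpace N] [ChartedSpace H N]

/-- The pull-back connection `f^*∇` in `f^*TM`, for a map `f : N → M`, on a section `σ` of `f^*TM`: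
if `σ = ∑ σ^i • (s_i ∘ f)` near `n` for the local frame `s_i` of `TM` given by the trivialization
at `f n`, then `(f^*∇)_X σ = ∑ dσ^i(X) • s_i + ∑ σ^i(n) • ∇_{df X} s_i`.
See `pullbackCov_comp`, `pullbackCov_add`, `pullbackCov_smul` for the characteristic properties. -/
noncomputable def pullbackCov (cov : Connection E M) (f : N → M)
    (σ : Π n, TangentSpace 𝓘(ℝ, E) (f n)) (n : N) :
    TangentSpace I n →L[ℝ] TangentSpace 𝓘(ℝ, E) (f n) :=
  (trivializationAt E (TangentSpace 𝓘(ℝ, E)) (f n)).symmL ℝ (f n) ∘L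
      (mvfderiv I
        (fun m => (trivializationAt E (TangentSpace 𝓘(ℝ, E)) (f n) ⟨f m, σ m⟩).2) n) +
    (cov (extend E (σ n)) (f n)) ∘L (mfderiv I 𝓘(ℝ, E) f n)

/-- The connection in `End (f^*TM)` induced by `f^*∇`: for a section `S` of `End (f^*TM)`,
`((f^*∇)_X S) v = (f^*∇)_X (S s) - S ((f^*∇)_X s)`, where `s` is a local section of `f^*TM` through
`v` (here the pull-back of a vector field on `M` that extends `v`). -/
noncomputable def pullbackCovEnd (cov : Connection E M) (f : N → M)
    (S : Π n, TangentSpace 𝓘(ℝ, E) (f n) →L[ℝ] TangentSpace 𝓘(ℝ, E) (f n)) (n : N)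
    (X : TangentSpace I n) (v : TangentSpace 𝓘(ℝ, E) (f n)) : TangentSpace 𝓘(ℝ, E) (f n) :=
  pullbackCov I cov f (fun m => S m (extend E v (f m))) n X -
    S n (pullbackCov I cov f (fun m => extend E v (f m)) n X)

end pullback

/-- The covariant differential `(π^*∇)_X 𝒥` of the tautological section `𝒥 : p ↦ p.2` of
`End (π^*TM)`, where `π : p ↦ p.1` is the bundle projection. -/
noncomputable def nablaTaut (cov : Connection E M) (p : EndBundle E M) (X : TangentSpace (EndModel E) p)
    (v : TangentSpace 𝓘(ℝ, E) p.1) : TangentSpace 𝓘(ℝ, E) p.1 :=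
  pullbackCovEnd (EndModel E) cov (fun q : EndBundle E M => q.1) (fun q => q.2) p X v


lemma triv_eq {x : M} (y : M) (hy : y ∈ (chartAt E x).source) (v : TangentSpace 𝓘(ℝ, E) y) :
    (trivializationAt E (TangentSpace 𝓘(ℝ, E)) x ⟨y, v⟩).2 =
      (trivializationAt E (TangentSpace 𝓘(ℝ, E)) x).continuousLinearMapAt ℝ y v :=
  (Trivialization.continuousLinearMapAt_apply_of_mem ℝ (trivializationAt E (TangentSpace 𝓘(ℝ, E)) x) hy v).symm

/-- The connection at `x` in the preferred trivialization at `x`: `∇_u` of the local vector field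
with constant coordinates `v`. -/
noncomputable def christoffel (cov : Connection E M) (x : M) (u v : E) : E :=
  cov (extend E (x := x) (E := TangentSpace 𝓘(ℝ, E)) v) x u

/-- An endomorphism of `T_x M`, seen in the coordinates of the preferred chart at `x`. -/
noncomputable def endo (p : EndBundle E M) : E →L[ℝ] E := p.2

lemma nablaTaut_apply (cov : Connection E M) (p : EndBundle E M) (u : E) (B : E →L[ℝ] E) (v : E) :
    nablaTaut cov p (u, B) v = (B v + christoffel cov p.1 u (endo p v)
      - endo p (christoffel cov p.1 u v) : E) := by
  have h1 := (hasMFDerivAt_proj p).mfderiv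
  have h2 : (fun q : EndBundle E M => (trivializationAt E (TangentSpace 𝓘(ℝ, E)) p.1
      ⟨q.1, q.2 (extend E (x := p.1) (E := TangentSpace 𝓘(ℝ, E)) v q.1)⟩).2) =ᶠ[𝓝 p]
      (ContinuousLinearMap.apply ℝ E v) ∘ (coord p) := by
    filter_upwards [eventually_source p] with q hq
    rw [triv_eq _ hq, extend_eq hq]
    rfl
  have h3 : (fun q : EndBundle E M => (trivializationAt E (TangentSpace 𝓘(ℝ, E)) p.1
      ⟨q.1, extend E (x := p.1) (E := TangentSpace 𝓘(ℝ, E)) v q.1⟩).2) =ᶠ[𝓝 p] fun _ => v := by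
    filter_upwards [eventually_source p] with q hq
    rw [triv_eq _ hq, extend_eq hq, clmAt_symmL hq]
  have h4 := ((ContinuousLinearMap.apply ℝ E v).hasMFDerivAt.comp p (hasMFDerivAt_coord p))
  have h5 := (h4.congr_of_eventuallyEq h2).mfderiv
  have h6 := ((hasMFDerivAt_const (I := EndModel E) (I' := 𝓘(ℝ, E)) v p).congr_of_eventuallyEq
    h3).mfderiv
  have e0 : extend E (x := p.1) (E := TangentSpace 𝓘(ℝ, E)) v p.1 = v := extend_apply_self ..
  have s1 : ∀ w : E, (trivializationAt E (TangentSpace 𝓘(ℝ, E)) p.1).symmL ℝ p.1 w = w :=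
    fun w => congrArg (fun f : E →L[ℝ] E => f w) (symmL_self p.1)
  have k1 : pullbackCov (EndModel E) cov (fun q : EndBundle E M => q.1)
     (fun q => q.2 (extend E (x := p.1) (E := TangentSpace 𝓘(ℝ, E)) v q.1)) p (u, B) =
       (B v + christoffel cov p.1 u (endo p v) : E) := by
    refine congrArg₂ (HAdd.hAdd : E → E → E) ((s1 _).trans ?_) ?_
    · exact congrArg (fun f : E × (E →L[ℝ] E) →L[ℝ] E => f (u, B)) h5
    · refine congrArg₂ (fun (w : E) (f : E × (E →L[ℝ] E) →L[ℝ] E) =>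
        christoffel cov p.1 (f (u, B)) (endo p w)) e0 h1
  have k2 : pullbackCov (EndModel E) cov (fun q : EndBundle E M => q.1)
     (fun q => (extend E (x := p.1) (E := TangentSpace 𝓘(ℝ, E)) v q.1)) p (u, B) =
       (christoffel cov p.1 u v : E) := by
    refine Eq.trans (congrArg₂ (HAdd.hAdd : E → E → E) (x' := 0) ((s1 _).trans ?_) ?_) (zero_add _)
    · exact congrArg (fun f : E × (E →L[ℝ] E) →L[ℝ] E => f (u, B)) h6
    · refine congrArg₂ (fun (w : E) (f : E × (E →L[ℝ] E) →L[ℝ] E) =>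
        christoffel cov p.1 (f (u, B)) w) e0 h1
  exact congrArg₂ (fun a b : E => a - endo p b) k1 k2

lemma mdiff_extend (x : M) (v : E) : MDifferentiableAt 𝓘(ℝ, E) (𝓘(ℝ, E).prod 𝓘(ℝ, E))
      (fun y => (⟨y, extend E (x := x) (E := TangentSpace 𝓘(ℝ, E)) v y⟩ :
        TotalSpace E (TangentSpace 𝓘(ℝ, E)))) x :=
  mdifferentiableAt_extend ..


lemma christoffel_add_right (cov : Connection E M) (x : M) (u v w : E) :
    christoffel cov x u (v + w) = christoffel cov x u v + christoffel cov x u w := by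
  have h := cov.isCovariantDerivativeOnUniv.add (mdiff_extend x v) (mdiff_extend x w)
  have h2 := cov.isCovariantDerivativeOnUniv.congr_of_eventuallyEq
    (mdiff_extend x (v + w)) (mdifferentiableAt_add_section (mdiff_extend x v) (mdiff_extend x w))
    Filter.univ_mem (by
      filter_upwards [(chartAt E x).open_source.mem_nhds (mem_chart_source E x)] with y hy
      rw [Pi.add_apply, extend_eq hy, extend_eq hy, extend_eq hy, map_add])
  exact congrArg (fun f : E →L[ℝ] E => f u) (h2.trans h)

lemma christoffel_smul_right (cov : Connection E M) (x : M) (u v : E) (c : ℝ) :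
    christoffel cov x u (c • v) = c • christoffel cov x u v := by
  have h := cov.isCovariantDerivativeOnUniv.smul_const c (mdiff_extend x v)
  have h2 := cov.isCovariantDerivativeOnUniv.congr_of_eventuallyEq
    (mdiff_extend x (c • v)) (mdifferentiableAt_const.smul_section (f := fun _ => c) (mdiff_extend x v))
    Filter.univ_mem (by
      filter_upwards [(chartAt E x).open_source.mem_nhds (mem_chart_source E x)] with y hy
      rw [Pi.smul_apply', extend_eq hy, extend_eq hy, map_smul])
  exact congrArg (fun f : E →L[ℝ] E => f u) (h2.trans h)

/-- The local formula for a connection. -/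
lemma cov_eq_local [FiniteDimensional ℝ E] (cov : Connection E M) (x : M)
    (s : Π x : M, TangentSpace 𝓘(ℝ, E) x)
    (hs : MDifferentiableAt 𝓘(ℝ, E) (𝓘(ℝ, E).prod 𝓘(ℝ, E))
      (fun y => (⟨y, s y⟩ : TotalSpace E (TangentSpace 𝓘(ℝ, E)))) x) (u : E) :
    cov s x u = (mvfderiv 𝓘(ℝ, E) (fun y =>
      (trivializationAt E (TangentSpace 𝓘(ℝ, E)) x ⟨y, s y⟩).2) x u + christoffel cov x u (s x) : E) := by
  let T : (Π x : M, TangentSpace 𝓘(ℝ, E) x) → M → E := fun s y =>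
    (trivializationAt E (TangentSpace 𝓘(ℝ, E)) x ⟨y, s y⟩).2
  have hT : ∀ (s : Π x : M, TangentSpace 𝓘(ℝ, E) x) {y}, y ∈ (chartAt E x).source → T s y =
    (trivializationAt E (TangentSpace 𝓘(ℝ, E)) x).continuousLinearMapAt ℝ y (s y) :=
    fun s y hy => triv_eq y hy (s y)
  let Φ : (Π x : M, TangentSpace 𝓘(ℝ, E) x) → (E →L[ℝ] E) := fun s =>
    HSub.hSub (α := E →L[ℝ] E) (β := E →L[ℝ] E) (cov s x) (mvfderiv 𝓘(ℝ, E) (T s) x)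
  have hdiff : ∀ {s : Π x : M, TangentSpace 𝓘(ℝ, E) x},
      MDifferentiableAt 𝓘(ℝ, E) (𝓘(ℝ, E).prod 𝓘(ℝ, E))
      (fun y => (⟨y, s y⟩ : TotalSpace E (TangentSpace 𝓘(ℝ, E)))) x →
      MDifferentiableAt 𝓘(ℝ, E) 𝓘(ℝ, E) (T s) x :=
    fun hs => (mdifferentiableAt_section _ _).1 hs
  have hcongr : ∀ {f g : M → E}, f =ᶠ[𝓝 x] g → mvfderiv 𝓘(ℝ, E) f x = mvfderiv 𝓘(ℝ, E) g x := by
    intro f g h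
    refine ContinuousLinearMap.ext fun w => ?_
    exact congrArg (fun L : E →L[ℝ] E => L w) h.mfderiv_eq
  have hev := (chartAt E x).open_source.mem_nhds (mem_chart_source E x)
  have hΦ : TensorialAt 𝓘(ℝ, E) E Φ x := by
    constructor
    · intro f σ hf hσ
      have h1 := cov.isCovariantDerivativeOnUniv.leibniz hσ hf
      have h2 := mvfderiv_smul hf (hdiff hσ)
      have h3 : T (f • σ) =ᶠ[𝓝 x] f • T σ := by
        filter_upwards [hev] with y hy
        rw [Pi.smul_apply', hT _ hy, hT _ hy, Pi.smul_apply', map_smul]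
      have h4 : T σ x = σ x := triv_self x (σ x)
      refine ContinuousLinearMap.ext fun w => ?_
      have e1 := congrArg (fun L : E →L[ℝ] E => L w) h1
      have e2 := congrArg (fun L : E →L[ℝ] E => L w) ((hcongr h3).trans h2)
      rw [h4] at e2
      refine (congrArg₂ (fun a b : E => a - b) e1 e2).trans ?_
      refine (add_sub_add_right_eq_sub (G := E) _ _ _).trans ?_
      exact (smul_sub (f x) _ _).symm
    · intro σ σ' hσ hσ'
      have h1 := cov.isCovariantDerivativeOnUniv.add hσ hσ'
      have h2 := mvfderiv_add (hdiff hσ) (hdiff hσ')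
      have h3 : T (σ + σ') =ᶠ[𝓝 x] T σ + T σ' := by
        filter_upwards [hev] with y hy
        rw [Pi.add_apply, hT _ hy, hT _ hy, hT _ hy, Pi.add_apply, map_add]
      refine ContinuousLinearMap.ext fun w => ?_
      have e1 := congrArg (fun L : E →L[ℝ] E => L w) h1
      have e2 := congrArg (fun L : E →L[ℝ] E => L w) ((hcongr h3).trans h2)
      refine (congrArg₂ (fun a b : E => a - b) e1 e2).trans ?_
      exact add_sub_add_comm (α := E) _ _ _ _
  have h0 := hΦ.pointwise (σ' := extend E (s x)) hs (mdifferentiableAt_extend 𝓘(ℝ, E) E (s x))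
    (extend_apply_self E (s x)).symm
  have h5 : T (extend E (s x)) =ᶠ[𝓝 x] fun _ => (s x : E) := by
    filter_upwards [hev] with y hy
    refine (hT _ hy).trans ?_
    refine Eq.trans (congrArg _ (extend_eq hy (s x))) ?_
    exact clmAt_symmL hy (s x)
  have h6 : mvfderiv 𝓘(ℝ, E) (T (extend E (s x))) x = 0 :=
    (hcongr h5).trans (mvfderiv_const (F := E) (I := 𝓘(ℝ, E)) (s x : E))
  have e0 := congrArg (fun L : E →L[ℝ] E => L u) h0
  have e6 := congrArg (fun L : E →L[ℝ] E => L u) h6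
  have e7 : HSub.hSub (α := E) (β := E) (cov s x u) (mvfderiv 𝓘(ℝ, E) (T s) x u) =
      christoffel cov x u (s x) := by
    refine e0.trans ?_
    refine (congrArg (fun b : E => christoffel cov x u (s x) - b) e6).trans ?_
    exact sub_zero (G := E) _
  exact (sub_eq_iff_eq_add'.1 e7)

/-- The pull-back connection on pulled-back sections: `(f^*∇)_X (s ∘ f) = ∇_{df X} s`. -/
lemma pullbackCov_comp [FiniteDimensional ℝ E]
    {F : Type*} [NormedAddCommGroup F] [NormedSpace ℝ F] {H : Type*} [TopologicalSpace H]
    (I : ModelWithCorners ℝ F H) {N : Type*} [TopologicalSpace N] [ChartedSpace H N]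
    (cov : Connection E M) (f : N → M)
    (s : Π x : M, TangentSpace 𝓘(ℝ, E) x) (n : N)
    (hf : MDifferentiableAt I 𝓘(ℝ, E) f n)
    (hs : MDifferentiableAt 𝓘(ℝ, E) (𝓘(ℝ, E).prod 𝓘(ℝ, E))
      (fun x => (⟨x, s x⟩ : TotalSpace E (TangentSpace 𝓘(ℝ, E)))) (f n)) (X : TangentSpace I n) :
    pullbackCov I cov f (fun m => s (f m)) n X = cov s (f n) (mfderiv I 𝓘(ℝ, E) f n X) := by
  have h1 := cov_eq_local cov (f n) s hs (mfderiv I 𝓘(ℝ, E) f n X)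
  have hd : MDifferentiableAt 𝓘(ℝ, E) 𝓘(ℝ, E) (fun y =>
    (trivializationAt E (TangentSpace 𝓘(ℝ, E)) (f n) ⟨y, s y⟩).2) (f n) :=
    (mdifferentiableAt_section _ _).1 hs
  have h2 : mvfderiv 𝓘(ℝ, E) (fun y =>
      (trivializationAt E (TangentSpace 𝓘(ℝ, E)) (f n) ⟨y, s y⟩).2) (f n)
        (mfderiv I 𝓘(ℝ, E) f n X) =
      mvfderiv I (fun m => (trivializationAt E (TangentSpace 𝓘(ℝ, E)) (f n) ⟨f m, s (f m)⟩).2) n X :=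
    congrArg (fun L : F →L[ℝ] E => L X) (mfderiv_comp n hd hf).symm
  refine Eq.trans ?_ h1.symm
  refine congrArg₂ (HAdd.hAdd : E → E → E) ?_ rfl
  refine Eq.trans ?_ h2.symm
  exact congrArg (fun L : E →L[ℝ] E => L _) (symmL_self (f n))

/-- The pull-back connection is additive. -/
lemma pullbackCov_add
    {F : Type*} [NormedAddCommGroup F] [NormedSpace ℝ F] {H : Type*} [TopologicalSpace H]
    (I : ModelWithCorners ℝ F H) {N : Type*} [TopologicalSpace N] [ChartedSpace H N]
    (cov : Connection E M) (f : N → M)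
    (σ σ' : Π n : N, TangentSpace 𝓘(ℝ, E) (f n)) (n : N)
    (hσ : MDifferentiableAt I (𝓘(ℝ, E).prod 𝓘(ℝ, E))
      (fun m => (⟨f m, σ m⟩ : TotalSpace E (TangentSpace 𝓘(ℝ, E)))) n)
    (hσ' : MDifferentiableAt I (𝓘(ℝ, E).prod 𝓘(ℝ, E))
      (fun m => (⟨f m, σ' m⟩ : TotalSpace E (TangentSpace 𝓘(ℝ, E)))) n) (X : TangentSpace I n) :
    pullbackCov I cov f (fun m => σ m + σ' m) n X =
      pullbackCov I cov f σ n X + pullbackCov I cov f σ' n X := by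
  have hf := ((mdifferentiableAt_totalSpace _ _).1 hσ).1
  have h1 := ((mdifferentiableAt_totalSpace _ _).1 hσ).2
  have h2 := ((mdifferentiableAt_totalSpace _ _).1 hσ').2
  have hev := hf.continuousAt ((chartAt E (f n)).open_source.mem_nhds (mem_chart_source E (f n)))
  let T : (Π n : N, TangentSpace 𝓘(ℝ, E) (f n)) → N → E := fun σ m =>
    (trivializationAt E (TangentSpace 𝓘(ℝ, E)) (f n) ⟨f m, σ m⟩).2
  have h3 : T (fun m => σ m + σ' m) =ᶠ[𝓝 n] T σ + T σ' := by
    filter_upwards [hev] with y hy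
    exact (triv_eq _ hy _).trans ((map_add _ _ _).trans
      (congrArg₂ (HAdd.hAdd : E → E → E) (triv_eq _ hy _).symm (triv_eq _ hy _).symm))
  have h4 : mvfderiv I (T (fun m => σ m + σ' m)) n X = mvfderiv I (T σ) n X + mvfderiv I (T σ') n X :=
    (congrArg (fun L : F →L[ℝ] E => L X) h3.mfderiv_eq).trans
      (congrArg (fun L : F →L[ℝ] E => L X) (mvfderiv_add h1 h2))
  have s1 : ∀ (τ : Π n : N, TangentSpace 𝓘(ℝ, E) (f n)), pullbackCov I cov f τ n X =
      HAdd.hAdd (α := E) (β := E) (mvfderiv I (T τ) n X)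
        (christoffel cov (f n) (mfderiv I 𝓘(ℝ, E) f n X) (τ n)) :=
    fun τ => congrArg₂ (HAdd.hAdd : E → E → E)
      (congrArg (fun L : E →L[ℝ] E => L (mvfderiv I (T τ) n X)) (symmL_self (f n))) rfl
  refine (s1 _).trans (Eq.trans ?_ (congrArg₂ (HAdd.hAdd : E → E → E) (s1 σ) (s1 σ')).symm)
  rw [h4]
  refine Eq.trans (congrArg (fun w : E => _ + w) (christoffel_add_right cov _ _ (σ n) (σ' n))) ?_
  exact add_add_add_comm (G := E) _ _ _ _

/-- The Leibniz rule for the pull-back connection. -/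
lemma pullbackCov_smul
    {F : Type*} [NormedAddCommGroup F] [NormedSpace ℝ F] {H : Type*} [TopologicalSpace H]
    (I : ModelWithCorners ℝ F H) {N : Type*} [TopologicalSpace N] [ChartedSpace H N]
    (cov : Connection E M) (f : N → M) (g : N → ℝ)
    (σ : Π n : N, TangentSpace 𝓘(ℝ, E) (f n)) (n : N)
    (hg : MDifferentiableAt I 𝓘(ℝ, ℝ) g n)
    (hσ : MDifferentiableAt I (𝓘(ℝ, E).prod 𝓘(ℝ, E))
      (fun m => (⟨f m, σ m⟩ : TotalSpace E (TangentSpace 𝓘(ℝ, E)))) n) (X : TangentSpace I n) :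
    pullbackCov I cov f (fun m => g m • σ m) n X =
      g n • pullbackCov I cov f σ n X + mvfderiv I g n X • σ n := by
  have hf := ((mdifferentiableAt_totalSpace _ _).1 hσ).1
  have h1 := ((mdifferentiableAt_totalSpace _ _).1 hσ).2
  have hev := hf.continuousAt ((chartAt E (f n)).open_source.mem_nhds (mem_chart_source E (f n)))
  let T : (Π n : N, TangentSpace 𝓘(ℝ, E) (f n)) → N → E := fun σ m =>
    (trivializationAt E (TangentSpace 𝓘(ℝ, E)) (f n) ⟨f m, σ m⟩).2
  have h3 : T (fun m => g m • σ m) =ᶠ[𝓝 n] g • T σ := by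
    filter_upwards [hev] with y hy
    exact (triv_eq _ hy _).trans ((map_smul _ _ _).trans
      (congrArg (fun w : E => g y • w) (triv_eq _ hy _).symm))
  have h4 : mvfderiv I (T (fun m => g m • σ m)) n X =
      g n • mvfderiv I (T σ) n X + mvfderiv I g n X • T σ n :=
    (congrArg (fun L : F →L[ℝ] E => L X) h3.mfderiv_eq).trans
      (congrArg (fun L : F →L[ℝ] E => L X) (mvfderiv_smul hg h1))
  have s1 : ∀ (τ : Π n : N, TangentSpace 𝓘(ℝ, E) (f n)), pullbackCov I cov f τ n X =
      HAdd.hAdd (α := E) (β := E) (mvfderiv I (T τ) n X)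
        (christoffel cov (f n) (mfderiv I 𝓘(ℝ, E) f n X) (τ n)) :=
    fun τ => congrArg₂ (HAdd.hAdd : E → E → E)
      (congrArg (fun L : E →L[ℝ] E => L (mvfderiv I (T τ) n X)) (symmL_self (f n))) rfl
  have s2 : T σ n = σ n := triv_self (f n) (σ n)
  refine (s1 _).trans (Eq.trans ?_ (congrArg (fun w : E =>
    HAdd.hAdd (α := E) (β := E) (g n • w) (mvfderiv I g n X • σ n)) (s1 σ)).symm)
  rw [h4, s2]
  refine Eq.trans (congrArg (fun w : E => _ + w) (christoffel_smul_right cov _ _ (σ n) (g n))) ?_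
  rw [smul_add]
  exact add_right_comm (G := E) _ _ _

lemma endo_sq {p : EndBundle E M} (hp : p ∈ twistorSpace E M) : endo p * endo p = -1 := hp

lemma anticomm_of_isTangent {p : EndBundle E M} {u : E} {B : E →L[ℝ] E}
    (h : IsTangent p (u, B)) : endo p * B + B * endo p = 0 := by
  obtain ⟨γ, hγ, hJ, ht⟩ := h
  obtain rfl : γ 0 = p := congrArg TotalSpace.proj ht
  have hX : mfderiv 𝓘(ℝ, ℝ) (EndModel E) γ 0 (1 : ℝ) = (u, B) := by
    have := TotalSpace.mk_inj.1 ht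
    exact this
  have hd := (hγ.mdifferentiableAt (by simp)).hasMFDerivAt
  let L : ℝ →L[ℝ] E × (E →L[ℝ] E) := mfderiv 𝓘(ℝ, ℝ) (EndModel E) γ 0
  have hcf : HasFDerivAt (coord (γ 0) ∘ γ)
      (ContinuousLinearMap.snd ℝ E (E →L[ℝ] E) ∘L L) (0 : ℝ) :=
    ((hasMFDerivAt_coord (γ 0)).comp 0 hd).hasFDerivAt
  have hc' := hcf.hasDerivAt
  have e : (ContinuousLinearMap.snd ℝ E (E →L[ℝ] E) ∘L L) 1 = B :=
    congrArg (fun X : E × (E →L[ℝ] E) => X.2) hX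
  rw [e] at hc'
  have hm := hc'.mul hc'
  have hev : (coord (γ 0) ∘ γ) * (coord (γ 0) ∘ γ) =ᶠ[𝓝 0] fun _ => -1 := by
    have h1 := hγ.continuousAt.eventually (eventually_source (γ 0))
    filter_upwards [hJ, h1] with t ht h1
    exact (mem_twistorSpace_iff_coord h1).1 ht
  have h0 := hm.unique ((hasDerivAt_const (0 : ℝ) (-1 : E →L[ℝ] E)).congr_of_eventuallyEq hev)
  rw [Function.comp_apply, coord_self] at h0
  rw [add_comm]
  exact h0

lemma isTangent_of_anticomm [CompleteSpace E] {p : EndBundle E M} (hp : p ∈ twistorSpace E M)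
    (u : E) (B : E →L[ℝ] E)
    (hB : endo p * B + B * endo p = 0) : IsTangent p (u, B) := by
  have ha := endo_sq hp
  set a := endo p with ha_def
  set C : E →L[ℝ] E := (-(1/2 : ℝ)) • (B * a) with hC
  let g : ℝ → (E →L[ℝ] E) := fun t => 1 + t • C
  let k : ℝ → (E →L[ℝ] E) := fun t => g t * a * Ring.inverse (g t)
  have hg : ContDiff ℝ ∞ g := contDiff_const.add (contDiff_id.smul contDiff_const)
  have hg0 : g 0 = 1 := by simp [g]
  have hk : ContDiffAt ℝ ∞ k 0 := by
    refine (hg.contDiffAt.mul contDiffAt_const).mul ?_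
    have : ContDiffAt ℝ ∞ Ring.inverse (g 0) := by
      rw [hg0]; exact contDiffAt_ringInverse ℝ (1 : (E →L[ℝ] E)ˣ)
    exact this.comp 0 hg.contDiffAt
  have hu : ∀ᶠ t in 𝓝 (0 : ℝ), IsUnit (g t) := by
    have := (Units.isOpen (R := E →L[ℝ] E)).mem_nhds (show IsUnit (g 0) by rw [hg0]; exact isUnit_one)
    exact hg.continuous.continuousAt this
  have hk0 : k 0 = a := by simp [k, hg0]
  have hkd : HasDerivAt k B 0 := by
    have h1 := (hk.differentiableAt (by simp)).hasDerivAt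
    have hgd : HasDerivAt g C 0 := by
      simpa [g] using ((hasDerivAt_id (0 : ℝ)).smul_const C).const_add (1 : E →L[ℝ] E)
    have h2 := h1.mul hgd
    have h3 := hgd.mul_const a
    have h4 : k * g =ᶠ[𝓝 0] fun t => g t * a := by
      filter_upwards [hu] with t ht
      simp [k, mul_assoc, Ring.inverse_mul_cancel _ ht]
    have h5 := h2.unique (h3.congr_of_eventuallyEq h4)
    rw [hk0, hg0, mul_one] at h5
    have h6 : deriv k 0 = B := by
      have e1 : a * B = - (B * a) := eq_neg_of_add_eq_zero_left hB
      have e2 : a * (B * a) = B := by rw [← mul_assoc, e1, neg_mul, mul_assoc, ha]; simp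
      have e3 : (B * a) * a = -B := by rw [mul_assoc, ha]; simp
      rw [eq_sub_of_add_eq h5, hC, smul_mul_assoc, mul_smul_comm, e2, e3]
      module
    rwa [h6] at h1
  let c : ℝ → E × (E →L[ℝ] E) := fun t => (extChartAt 𝓘(ℝ, E) p.1 p.1 + t • u, k t)
  have hc : ContDiffAt ℝ ∞ c 0 :=
    (contDiffAt_const.add (contDiffAt_id.smul contDiffAt_const)).prodMk hk
  have hcd : HasDerivAt c (u, B) 0 := by
    refine HasDerivAt.prodMk ?_ hkd
    simpa using ((hasDerivAt_id (0 : ℝ)).smul_const u).const_add (extChartAt 𝓘(ℝ, E) p.1 p.1)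
  have hc0 : c 0 = extChartAt (EndModel E) p p := by
    rw [extChartAt_apply, coord_self]
    simp only [c, hk0, zero_smul, add_zero]; rfl
  have htar : ∀ᶠ t in 𝓝 (0 : ℝ), c t ∈ (extChartAt (EndModel E) p).target := by
    have := extChartAt_target_mem_nhds (I := EndModel E) p
    rw [← hc0] at this
    exact hc.continuousAt this
  let γ : ℝ → EndBundle E M := fun t => (extChartAt (EndModel E) p).symm (c t)
  have hγ0 : γ 0 = p := by
    simp only [γ, hc0]; exact extChartAt_to_inv p
  have hγ : ContMDiffAt 𝓘(ℝ, ℝ) (EndModel E) ∞ γ 0 := by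
    have h1 : ContMDiffAt 𝓘(ℝ, E × (E →L[ℝ] E)) (EndModel E) ∞ (extChartAt (EndModel E) p).symm
        (c 0) := by
      rw [hc0]
      exact (contMDiffOn_extChartAt_symm (I := EndModel E) (n := ∞) p).contMDiffAt
        (extChartAt_target_mem_nhds (I := EndModel E) p)
    exact h1.comp 0 hc.contMDiffAt
  have hmem : ∀ᶠ t in 𝓝 (0 : ℝ), extChartAt (EndModel E) p (γ t) = c t := by
    filter_upwards [htar] with t ht
    exact (extChartAt (EndModel E) p).right_inv ht
  refine ⟨γ, hγ, ?_, ?_⟩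
  · have h1 : ∀ᶠ t in 𝓝 (0 : ℝ), (γ t).1 ∈ (chartAt E p.1).source := by
      have h2 := eventually_source p
      rw [← hγ0] at h2
      have := hγ.continuousAt.eventually h2
      rwa [hγ0] at this
    filter_upwards [hmem, hu, h1] with t ht htu h1
    rw [mem_twistorSpace_iff_coord h1]
    rw [extChartAt_apply] at ht
    have e : coord p (γ t) = k t := congrArg Prod.snd ht
    rw [e]
    simp only [k]
    rw [mul_assoc, mul_assoc, ← mul_assoc (Ring.inverse (g t)), ← mul_assoc (Ring.inverse (g t)),
      Ring.inverse_mul_cancel _ htu, one_mul, ← mul_assoc a, ha, neg_one_mul, mul_neg,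
      Ring.mul_inverse_cancel _ htu]
  · have hd := (hγ.mdifferentiableAt (by simp)).hasMFDerivAt
    have hfin : ∀ q, γ 0 = q → HasMFDerivAt (EndModel E) 𝓘(ℝ, E × (E →L[ℝ] E))
        (extChartAt (EndModel E) p) q (ContinuousLinearMap.id ℝ (E × (E →L[ℝ] E))) →
        tangentMap 𝓘(ℝ, ℝ) (EndModel E) γ ⟨0, (1 : ℝ)⟩ =
          (⟨q, (u, B)⟩ : TangentBundle (EndModel E) (EndBundle E M)) := by
      rintro q rfl hq
      let L : ℝ →L[ℝ] E × (E →L[ℝ] E) := mfderiv 𝓘(ℝ, ℝ) (EndModel E) γ 0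
      have h1 : HasFDerivAt (extChartAt (EndModel E) p ∘ γ)
        (ContinuousLinearMap.id ℝ (E × (E →L[ℝ] E)) ∘L L) (0 : ℝ) := (hq.comp 0 hd).hasFDerivAt
      have h2 := h1.hasDerivAt.unique (hcd.congr_of_eventuallyEq hmem)
      exact congrArg (fun X : E × (E →L[ℝ] E) =>
        (⟨γ 0, X⟩ : TangentBundle (EndModel E) (EndBundle E M))) h2
    exact hfin p hγ0 (hasMFDerivAt_extChartAt_self p)

lemma isTangent_iff [CompleteSpace E] {p : EndBundle E M} (hp : p ∈ twistorSpace E M)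
    (u : E) (B : E →L[ℝ] E) :
    IsTangent p (u, B) ↔ endo p * B + B * endo p = 0 :=
  ⟨anticomm_of_isTangent, isTangent_of_anticomm hp u B⟩

/-- The tangent space of `J(M)` at `p`. -/
noncomputable def twistorTangent [FiniteDimensional ℝ E] (p : twistorSpace E M) :
    Submodule ℝ (TangentSpace (EndModel E) p.1) where
  carrier := {X | IsTangent p.1 X}
  add_mem' := by
    rintro ⟨u, B⟩ ⟨u', B'⟩ h h'
    have := FiniteDimensional.complete ℝ E
    replace h := anticomm_of_isTangent h
    replace h' := anticomm_of_isTangent h'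
    refine isTangent_of_anticomm p.2 (u + u') (B + B') ?_
    rw [mul_add, add_mul, add_add_add_comm, h, h', add_zero]
  zero_mem' :=
    have := FiniteDimensional.complete ℝ E
    isTangent_of_anticomm p.2 0 0 (by simp)
  smul_mem' := by
    rintro r ⟨u, B⟩ h
    have := FiniteDimensional.complete ℝ E
    replace h := anticomm_of_isTangent h
    refine isTangent_of_anticomm p.2 (r • u) (r • B) ?_
    rw [mul_smul_comm, smul_mul_assoc, ← smul_add, h, smul_zero]

/-- The equations `dπ(J X) = 𝒥 dπ(X)` and `(π^*∇)_{J X} 𝒥 = 𝒥 (π^*∇)_X 𝒥` for an endomorphism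
`J` of the tangent space `T_p J(M)`. -/
structure IsTwistorStructure [FiniteDimensional ℝ E] (cov : Connection E M)
    (p : twistorSpace E M) (J : twistorTangent p →ₗ[ℝ] twistorTangent p) : Prop where
  proj : ∀ X : twistorTangent p,
    mfderiv (EndModel E) 𝓘(ℝ, E) (fun q : EndBundle E M => q.1) p.1 (J X) =
      p.1.2 (mfderiv (EndModel E) 𝓘(ℝ, E) (fun q : EndBundle E M => q.1) p.1 X)
  nabla : ∀ (X : twistorTangent p) (v : TangentSpace 𝓘(ℝ, E) p.1.1),
    nablaTaut cov p.1 (J X) v = p.1.2 (nablaTaut cov p.1 X v)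

/-- `christoffel`, as an endomorphism. -/
noncomputable def christoffelEnd [FiniteDimensional ℝ E] (cov : Connection E M) (x : M) (u : E) : E →L[ℝ] E :=
  LinearMap.toContinuousLinearMap
    { toFun := christoffel cov x u
      map_add' := christoffel_add_right cov x u
      map_smul' := fun c v => christoffel_smul_right cov x u v c }

lemma christoffelEnd_add [FiniteDimensional ℝ E] (cov : Connection E M) (x : M) (u v : E) :
    christoffelEnd cov x (u + v) = christoffelEnd cov x u + christoffelEnd cov x v :=
  ContinuousLinearMap.ext fun w =>
    map_add (cov (extend E (x := x) (E := TangentSpace 𝓘(ℝ, E)) w) x : E →L[ℝ] E) u v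

lemma christoffelEnd_smul [FiniteDimensional ℝ E] (cov : Connection E M) (x : M) (c : ℝ) (u : E) :
    christoffelEnd cov x (c • u) = c • christoffelEnd cov x u :=
  ContinuousLinearMap.ext fun w =>
    map_smul (cov (extend E (x := x) (E := TangentSpace 𝓘(ℝ, E)) w) x : E →L[ℝ] E) c u

lemma mfderiv_proj_apply (p : EndBundle E M) (u : E) (B : E →L[ℝ] E) :
    mfderiv (EndModel E) 𝓘(ℝ, E) (fun q : EndBundle E M => q.1) p (u, B) = u :=
  congrArg (fun f : E × (E →L[ℝ] E) →L[ℝ] E => f (u, B)) (hasMFDerivAt_proj p).mfderiv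

lemma nablaTaut_eq [FiniteDimensional ℝ E] (cov : Connection E M) (p : EndBundle E M)
    (u : E) (B : E →L[ℝ] E) (v : E) :
    nablaTaut cov p (u, B) v = (B + christoffelEnd cov p.1 u * endo p
      - endo p * christoffelEnd cov p.1 u) v :=
  nablaTaut_apply cov p u B v

/-- A tangent vector is determined by its horizontal and vertical components. -/
lemma eq_of_proj_nablaTaut [FiniteDimensional ℝ E] (cov : Connection E M) (p : EndBundle E M)
    {X Y : E × (E →L[ℝ] E)}
    (h1 : mfderiv (EndModel E) 𝓘(ℝ, E) (fun q : EndBundle E M => q.1) p X =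
      mfderiv (EndModel E) 𝓘(ℝ, E) (fun q : EndBundle E M => q.1) p Y)
    (h2 : ∀ v, nablaTaut cov p X v = nablaTaut cov p Y v) : X = Y := by
  obtain ⟨u, B⟩ := X
  obtain ⟨u', B'⟩ := Y
  obtain rfl : u = u' := (mfderiv_proj_apply p u B).symm.trans (h1.trans (mfderiv_proj_apply p u' B'))
  have h3 : B + christoffelEnd cov p.1 u * endo p - endo p * christoffelEnd cov p.1 u =
      B' + christoffelEnd cov p.1 u * endo p - endo p * christoffelEnd cov p.1 u :=
    ContinuousLinearMap.ext fun v =>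
      (nablaTaut_eq cov p u B v).symm.trans ((h2 v).trans (nablaTaut_eq cov p u B' v))
  rw [add_sub_assoc, add_sub_assoc] at h3
  rw [add_right_cancel h3]

/-- Coordinate expression of the structure. -/
noncomputable def twistorAux [FiniteDimensional ℝ E] (cov : Connection E M) (p : EndBundle E M) :
    E × (E →L[ℝ] E) →ₗ[ℝ] E × (E →L[ℝ] E) where
  toFun X := (endo p X.1,
    endo p * (X.2 + christoffelEnd cov p.1 X.1 * endo p - endo p * christoffelEnd cov p.1 X.1)
      - christoffelEnd cov p.1 (endo p X.1) * endo p
      + endo p * christoffelEnd cov p.1 (endo p X.1))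
  map_add' X Y := by
    ext1
    · simp
    · simp only [Prod.fst_add, Prod.snd_add, map_add, christoffelEnd_add]
      noncomm_ring
  map_smul' c X := by
    ext1
    · simp
    · simp only [Prod.smul_fst, Prod.smul_snd, map_smul, christoffelEnd_smul, RingHom.id_apply,
        smul_mul_assoc, mul_smul_comm, smul_add, smul_sub, mul_add, mul_sub]

lemma twistorAux_mem [FiniteDimensional ℝ E] (cov : Connection E M) (p : twistorSpace E M)
    (X : E × (E →L[ℝ] E)) (hX : IsTangent p.1 X) : IsTangent p.1 (twistorAux cov p.1 X) := by
  have := FiniteDimensional.complete ℝ E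
  obtain ⟨u, B⟩ := X
  have h := anticomm_of_isTangent hX
  refine isTangent_of_anticomm p.2 _ _ ?_
  have ha := endo_sq p.2
  set a := endo p.1
  set G := christoffelEnd cov p.1.1 u
  set G' := christoffelEnd cov p.1.1 (a u)
  have e1 : a * B = - (B * a) := eq_neg_of_add_eq_zero_left h
  have e2 : ∀ Z : E →L[ℝ] E, a * (a * Z) = -Z := fun Z => by rw [← mul_assoc, ha]; simp
  have e3 : a * (B * a) = B := by rw [← mul_assoc, e1, neg_mul, mul_assoc, ha]; simp
  simp only [mul_add, mul_sub, add_mul, sub_mul, mul_assoc, e2, e3, ha, mul_neg, mul_one, neg_mul]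
  abel

/-- There is exactly one endomorphism of `T_p J(M)` with the defining properties. -/
theorem existsUnique_twistorStructure [FiniteDimensional ℝ E] (cov : Connection E M)
    (p : twistorSpace E M) :
    ∃! J : twistorTangent p →ₗ[ℝ] twistorTangent p, IsTwistorStructure cov p J := by
  refine ⟨LinearMap.restrict (twistorAux cov p.1) (twistorAux_mem cov p), ⟨?_, ?_⟩, ?_⟩
  · rintro ⟨⟨u, B⟩, hX⟩
    refine (mfderiv_proj_apply p.1 _ _).trans ?_
    exact congrArg (endo p.1) (mfderiv_proj_apply p.1 u B).symm
  · rintro ⟨⟨u, B⟩, hX⟩ v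
    refine (nablaTaut_eq cov p.1 _ _ v).trans ?_
    refine Eq.trans ?_ (congrArg (endo p.1) (nablaTaut_eq cov p.1 u B v).symm)
    change _ = (endo p.1 * _) v
    congr 1
    noncomm_ring
  · intro J hJ
    refine LinearMap.ext fun X => Subtype.ext ?_
    obtain ⟨⟨u, B⟩, hX⟩ := X
    refine eq_of_proj_nablaTaut cov p.1 ?_ fun v => ?_
    · refine (hJ.proj _).trans ?_
      refine Eq.trans ?_ (mfderiv_proj_apply p.1 _ _).symm
      exact congrArg (endo p.1) (mfderiv_proj_apply p.1 u B)
    · refine (hJ.nabla _ v).trans ?_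
      refine Eq.trans ?_ (nablaTaut_eq cov p.1 _ _ v).symm
      refine Eq.trans (congrArg (endo p.1) (nablaTaut_eq cov p.1 u B v)) ?_
      change (endo p.1 * _) v = _
      congr 1
      noncomm_ring

/-- The almost complex structure `J^∇` on `J(M)`: at each `p`, the unique endomorphism `J` of
`T_p J(M)` with `dπ(J X) = 𝒥 dπ(X)` and `(π^*∇)_{J X} 𝒥 = 𝒥 (π^*∇)_X 𝒥`. -/
noncomputable def twistorStructure [FiniteDimensional ℝ E] (cov : Connection E M) (p : twistorSpace E M) :
    twistorTangent p →ₗ[ℝ] twistorTangent p :=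
  (existsUnique_twistorStructure cov p).choose

lemma twistorStructure_spec [FiniteDimensional ℝ E] (cov : Connection E M) (p : twistorSpace E M) :
    IsTwistorStructure cov p (twistorStructure cov p) :=
  (existsUnique_twistorStructure cov p).choose_spec.1

/-- `J^∇` squares to `-1`. -/
lemma twistorStructure_sq [FiniteDimensional ℝ E] (cov : Connection E M) (p : twistorSpace E M)
    (X : twistorTangent p) : twistorStructure cov p (twistorStructure cov p X) = -X := by
  have h := twistorStructure_spec cov p
  refine Subtype.ext (eq_of_proj_nablaTaut cov p.1 ?_ fun v => ?_)
  · rw [h.proj, h.proj, mem_twistorSpace.1 p.2]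
    obtain ⟨⟨u, B⟩, hX⟩ := X
    exact (congrArg (fun w : E => -w) (mfderiv_proj_apply p.1 u B)).trans
      (mfderiv_proj_apply p.1 (-u) (-B)).symm
  · rw [h.nabla, h.nabla, mem_twistorSpace.1 p.2]
    obtain ⟨⟨u, B⟩, hX⟩ := X
    refine Eq.trans (congrArg (fun w : E => -w) (nablaTaut_eq cov p.1 u B v)) ?_
    refine Eq.trans ?_ (nablaTaut_eq cov p.1 (-u) (-B) v).symm
    have : christoffelEnd cov p.1.1 (-u) = - christoffelEnd cov p.1.1 u := by
      simpa using christoffelEnd_smul cov p.1.1 (-1) u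
    rw [this]
    change (-(_) : E →L[ℝ] E) v = _
    congr 1
    noncomm_ring

/-- The torsion `T(X, Y) = ∇_X Y - ∇_Y X - [X, Y]` vanishes. -/
def IsTorsionFree [FiniteDimensional ℝ E] (cov : Connection E M) : Prop :=
  haveI := FiniteDimensional.complete ℝ E
  cov.torsion = 0

/-- `∇` and `∇'` are projectively equivalent: there is a smooth `1`-form `α` with
`∇'_X Y = ∇_X Y + α(X) Y + α(Y) X`. -/
def ProjectivelyEquivalent (cov cov' : Connection E M) : Prop :=
  ∃ α : Π x : M, TangentSpace 𝓘(ℝ, E) x →L[ℝ] ℝ,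
    ContMDiff 𝓘(ℝ, E) (𝓘(ℝ, E).prod 𝓘(ℝ, E →L[ℝ] ℝ)) ∞
      (fun x => TotalSpace.mk' (E →L[ℝ] ℝ)
        (E := fun x : M => TangentSpace 𝓘(ℝ, E) x →L[ℝ] Trivial M ℝ x) x (α x)) ∧
    ∀ (x : M) (Y : Π y : M, TangentSpace 𝓘(ℝ, E) y),
      MDifferentiableAt 𝓘(ℝ, E) (𝓘(ℝ, E).prod 𝓘(ℝ, E))
        (fun y => (⟨y, Y y⟩ : TotalSpace E (TangentSpace 𝓘(ℝ, E)))) x →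
      ∀ X : TangentSpace 𝓘(ℝ, E) x,
        cov' Y x X = cov Y x X + α x X • Y x + α x (Y x) • X

end Twistor

/-! At each point, `D = ∇' - ∇` is a bilinear map on the tangent space. The two connections give the
same horizontal part of `J X`, so only the vertical equation can distinguish them. Passing from `∇`
to `∇'` adds the commutator `[D_u, p]` to the covariant differential of the tautological section
along a vector over `u`. Hence `J^∇ = J^∇'` at `p` exactly when `[D_{pu}, p] = p [D_u, p]` for all
`u` (`twistorStructure_eq_iff`).

If `D_u v = α(u) v + α(v) u`, then `[D_u, p] v = α(pv) u - α(v) pu`. Replacing `u` by `pu`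
multiplies this by `p`, because `p² = -1`. This gives the first part and one direction of the
second.

For the converse, vanishing torsion makes `D` symmetric, and the criterion holds for every complex
structure `a` on the tangent space. With both arguments equal to `u` it reads `D(au, au) - D(u, u) =
2 a D(u, au)`. Given independent `u, w`, the structures with `a u = s w` form a family in `s ≠ 0`.
Comparing powers of `s` gives `D(u, u) = 2c u`, `D(w, w) = 2d w` and `D(u, w) = d u + c w`
(`exists_coeff_of_linearIndependent_pair`). The eigenvalues assemble into a linear form
(`exists_linear_of_forall_complexStructure`). That form is found pointwise, and it is smooth because
`D(s, s) = 2 α(s) s` recovers it from smooth data (`contMDiff_of_connectionDiff_eq`). -/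

namespace Twistor

/-! ### Linear algebra: complex structures adapted to a pair of vectors. -/

/-- A pair of linearly independent vectors in an even-dimensional space can be completed to linear
coordinates with values in `ℝ² × ℂᵏ`. -/
lemma exists_linearEquiv_of_linearIndependent_pair {E : Type*} [AddCommGroup E] [Module ℝ E]
    [FiniteDimensional ℝ E] (hE : Even (Module.finrank ℝ E)) {u w : E}
    (h : LinearIndependent ℝ ![u, w]) :
    ∃ (k : ℕ) (e : ((ℝ × ℝ) × (Fin k → ℂ)) ≃ₗ[ℝ] E),
      e ((1, 0), 0) = u ∧ e ((0, 1), 0) = w := by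
  let f : (ℝ × ℝ) →ₗ[ℝ] E :=
    (LinearMap.toSpanSingleton ℝ E u).coprod (LinearMap.toSpanSingleton ℝ E w)
  have hf : Function.Injective f := by
    rw [← LinearMap.ker_eq_bot, LinearMap.ker_eq_bot']
    rintro ⟨x, y⟩ hxy
    obtain ⟨rfl, rfl⟩ := LinearIndependent.pair_iff.1 h x y (by simpa [f] using hxy)
    rfl
  obtain ⟨V, hV⟩ := Submodule.exists_isCompl (LinearMap.range f)
  have h1 : Module.finrank ℝ (LinearMap.range f) = 2 := by
    rw [LinearMap.finrank_range_of_inj hf]; simp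
  have h2 := Submodule.finrank_add_eq_of_isCompl hV
  obtain ⟨n, hn⟩ := hE
  -- The complement of the plane has dimension `2n - 2`. The truncated subtraction is harmless: the
  -- plane itself forces `n ≥ 1`.
  have h3 : Module.finrank ℝ (Fin (n - 1) → ℂ) = Module.finrank ℝ V := by
    rw [Module.finrank_pi_fintype]
    simp only [Complex.finrank_real_complex, Finset.sum_const, Finset.card_univ, Fintype.card_fin,
      smul_eq_mul]
    omega
  let g : (Fin (n - 1) → ℂ) ≃ₗ[ℝ] V := LinearEquiv.ofFinrankEq _ _ h3
  refine ⟨n - 1, ((LinearEquiv.ofInjective f hf).prodCongr g).trans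
    (Submodule.prodEquivOfIsCompl _ _ hV), ?_, ?_⟩ <;> simp [f]

/-- The complex structure on `ℝ² × ℂᵏ` that is multiplication by `i` on `ℂᵏ` and sends `(1, 0)` to
`(0, s)` on `ℝ²`. -/
noncomputable def modelStructure (k : ℕ) (s : ℝ) :
    ((ℝ × ℝ) × (Fin k → ℂ)) →ₗ[ℝ] ((ℝ × ℝ) × (Fin k → ℂ)) where
  toFun x := ((-(s⁻¹ * x.1.2), s * x.1.1), Complex.I • x.2)
  map_add' x y := by ext <;> simp <;> ring
  map_smul' c x := by ext <;> simp <;> ring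

/-- The two off-diagonal entries `s` and `-s⁻¹` of the real block have product `-1` only for `s ≠
0`; at `s = 0` the block is zero. -/
lemma modelStructure_sq (k : ℕ) {s : ℝ} (hs : s ≠ 0) (x : (ℝ × ℝ) × (Fin k → ℂ)) :
    modelStructure k s (modelStructure k s x) = -x := by
  obtain ⟨⟨a, b⟩, z⟩ := x
  simp [modelStructure, hs, smul_smul]

/-! ### Linear algebra: symmetric bilinear maps satisfying the criterion for all complex structures.
-/

section
variable {E : Type*} [AddCommGroup E] [Module ℝ E] [FiniteDimensional ℝ E]

/-- A symmetric bilinear map whose `(0,2) → (1,0)` part vanishes for all complex structures,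
evaluated on a pair of linearly independent vectors. -/
lemma exists_coeff_of_linearIndependent_pair (hE : Even (Module.finrank ℝ E))
    {D : E →ₗ[ℝ] E →ₗ[ℝ] E} (hsymm : ∀ u v, D u v = D v u)
    (hD : ∀ a : E →ₗ[ℝ] E, (∀ v, a (a v) = -v) → ∀ u v,
      D (a u) (a v) - a (D (a u) v) = a (D u (a v) - a (D u v)))
    {u w : E} (h : LinearIndependent ℝ ![u, w]) :
    ∃ c d : ℝ, D u u = (2 * c) • u ∧ D w w = (2 * d) • w ∧ D u w = d • u + c • w := by
  obtain ⟨k, e, rfl, rfl⟩ := exists_linearEquiv_of_linearIndependent_pair hE h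
  set u := e ((1, 0), 0)
  set w := e ((0, 1), 0)
  -- The model structure is transported to `E` by `e`, so that `a u = s w`. By symmetry, the
  -- criterion at `(u, u)` becomes `s² D(w, w) - D(u, u) = 2s a D(u, w)`, read here in coordinates.
  have key : ∀ s : ℝ, s ≠ 0 → s ^ 2 • e.symm (D w w) - e.symm (D u u) =
      (2 * s) • modelStructure k s (e.symm (D u w)) := by
    intro s hs
    let a : E →ₗ[ℝ] E := e.toLinearMap ∘ₗ modelStructure k s ∘ₗ e.symm.toLinearMap
    have ha : ∀ v, a (a v) = -v := fun v => by simp [a, modelStructure_sq k hs]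
    have hau : a u = s • w := by
      have : modelStructure k s ((1, 0), 0) = s • ((0, 1), 0) := by simp [modelStructure]
      simp only [a, u, w, LinearMap.comp_apply, LinearEquiv.coe_coe, LinearEquiv.symm_apply_apply,
        this, map_smul]
    have h1 := hD a ha u u
    rw [hau] at h1
    simp only [map_smul, LinearMap.smul_apply, map_sub, ha, hsymm w u] at h1
    have h2 : s ^ 2 • D w w - D u u = (2 * s) • a (D u w) := by
      linear_combination (norm := module) h1
    have h3 := congrArg e.symm h2
    simpa [a] using h3
  rcases hp : e.symm (D w w) with ⟨⟨p1, p2⟩, p3⟩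
  rcases hq : e.symm (D u u) with ⟨⟨q1, q2⟩, q3⟩
  rcases hr : e.symm (D u w) with ⟨⟨r1, r2⟩, r3⟩
  rw [hp, hq, hr] at key
  -- The identity is polynomial in `s` of degree at most two once `s · s⁻¹` cancels. The values `1`,
  -- `-1`, `2` therefore separate its coefficients.
  have k1 := key 1 one_ne_zero
  have k2 := key (-1) (by norm_num)
  have k3 := key 2 two_ne_zero
  simp only [modelStructure, LinearMap.coe_mk, AddHom.coe_mk, Prod.smul_mk, Prod.mk_sub_mk,
    Prod.mk.injEq, smul_eq_mul] at k1 k2 k3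
  obtain ⟨⟨k1a, k1b⟩, k1c⟩ := k1
  obtain ⟨⟨k2a, k2b⟩, k2c⟩ := k2
  obtain ⟨⟨k3a, k3b⟩, k3c⟩ := k3
  -- On the real plane the identity is `s² p1 - q1 = -2 r2` and `s² p2 - q2 = 2 s² r1`.
  have p1z : p1 = 0 := by linarith
  have q1z : q1 = 2 * r2 := by linarith
  have q2z : q2 = 0 := by linarith
  have p2z : p2 = 2 * r1 := by linarith
  -- On the complex factor, `s² p3 - q3 = 2 s i r3`: the left side is even in `s`, the right side is
  -- odd, and all three coefficients vanish.
  have hz : p3 = 0 ∧ q3 = 0 ∧ r3 = 0 := by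
    have e1 : ∀ i, p3 i = 0 ∧ q3 i = 0 ∧ r3 i = 0 := fun i => by
      have a1 := congrFun k1c i
      have a2 := congrFun k2c i
      have a3 := congrFun k3c i
      simp only [Pi.sub_apply, Pi.smul_apply, Complex.real_smul, smul_eq_mul] at a1 a2 a3
      push_cast at a1 a2 a3
      have hp3 : p3 i = 0 := by linear_combination (a3 - (a1 + a2) / 2 - (a1 - a2)) / 3
      have hq3 : q3 i = 0 := by linear_combination hp3 - (a1 + a2) / 2
      have hr3 : Complex.I * r3 i = 0 := by linear_combination (a2 - a1) / 4
      exact ⟨hp3, hq3, (mul_eq_zero.1 hr3).resolve_left Complex.I_ne_zero⟩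
    exact ⟨funext fun i => (e1 i).1, funext fun i => (e1 i).2.1, funext fun i => (e1 i).2.2⟩
  obtain ⟨p3z, q3z, r3z⟩ := hz
  subst p1z q1z q2z p2z p3z q3z r3z
  refine ⟨r2, r1, ?_, ?_, ?_⟩
  · rw [← e.symm.injective.eq_iff, hq, map_smul]; simp [u]
  · rw [← e.symm.injective.eq_iff, hp, map_smul]; simp [w]
  · rw [← e.symm.injective.eq_iff, hr, map_add, map_smul, map_smul]; simp [u, w]

/-- A symmetric bilinear map whose `(0,2) → (1,0)` part vanishes for all complex structures is of
the form `α(u) v + α(v) u`. -/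
lemma exists_linear_of_forall_complexStructure (hE : Even (Module.finrank ℝ E))
    {D : E →ₗ[ℝ] E →ₗ[ℝ] E} (hsymm : ∀ u v, D u v = D v u)
    (hD : ∀ a : E →ₗ[ℝ] E, (∀ v, a (a v) = -v) → ∀ u v,
      D (a u) (a v) - a (D (a u) v) = a (D u (a v) - a (D u v))) :
    ∃ α : E →ₗ[ℝ] ℝ, ∀ u v, D u v = α u • v + α v • u := by
  -- At `u = 0` every `c` satisfies the equation. Normalising it to `0` there is what lets the
  -- chosen function be homogeneous and additive.
  have h1 : ∀ u : E, ∃ c : ℝ, D u u = (2 * c) • u ∧ (u = 0 → c = 0) := by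
    intro u
    rcases eq_or_ne u 0 with rfl | hu
    · exact ⟨0, by simp⟩
    have hpos : 0 < Module.finrank ℝ E := Module.finrank_pos_iff_exists_ne_zero.2 ⟨u, hu⟩
    -- A positive even dimension is at least two, so a partner for `u` exists.
    obtain ⟨w, hw⟩ := exists_linearIndependent_pair_of_one_lt_finrank (R := ℝ)
      (by obtain ⟨n, hn⟩ := hE; omega) hu
    obtain ⟨c, d, hc, -⟩ := exists_coeff_of_linearIndependent_pair hE hsymm hD hw
    exact ⟨c, hc, fun h => (hu h).elim⟩
  choose l hl hl0 using h1
  have hl_unique : ∀ {u : E}, u ≠ 0 → ∀ {c : ℝ}, D u u = (2 * c) • u → c = l u := by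
    intro u hu c hc
    have := smul_left_injective ℝ hu (hc.symm.trans (hl u))
    simpa using this
  have hsm : ∀ (c : ℝ) (u : E), l (c • u) = c * l u := by
    intro c u
    rcases eq_or_ne (c • u) 0 with h | h
    · rw [hl0 _ h]
      rcases smul_eq_zero.1 h with rfl | rfl
      · simp
      · simp [hl0 0 rfl]
    · refine (hl_unique h ?_).symm
      simp only [map_smul, LinearMap.smul_apply, hl u]
      module
  have hD2 : ∀ u v, D u v = l u • v + l v • u := by
    intro u v
    rcases eq_or_ne u 0 with rfl | hu
    · simp [hl0 0 rfl]
    by_cases h : LinearIndependent ℝ ![u, v]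
    · obtain ⟨c, d, hc, hd, hcd⟩ := exists_coeff_of_linearIndependent_pair hE hsymm hD h
      have hv : v ≠ 0 := h.ne_zero 1
      rw [hcd, hl_unique hu hc, hl_unique hv hd, add_comm]
    · rw [LinearIndependent.pair_iff' hu] at h
      push Not at h
      obtain ⟨c, rfl⟩ := h
      rw [hsm, map_smul, hl u]
      module
  -- For a nonzero test vector `x`, expand `D (u + v) x = D u x + D v x` with `hD2`. The terms
  -- containing `l x` cancel, leaving multiples of `x`.
  have hadd : ∀ u v, l (u + v) = l u + l v := by
    intro u v
    by_cases hn : ∃ x : E, x ≠ 0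
    · obtain ⟨x, hx⟩ := hn
      have h := hD2 (u + v) x
      rw [map_add, LinearMap.add_apply, hD2, hD2] at h
      have : (l (u + v)) • x = (l u + l v) • x := by
        rw [add_smul]
        linear_combination (norm := module) (-1 : ℝ) • h
      exact smul_left_injective ℝ hx this
    · push Not at hn
      simp [hl0 _ (hn u), hl0 _ (hn v), hl0 _ (hn (u + v))]
  exact ⟨{ toFun := l, map_add' := hadd, map_smul' := hsm }, hD2⟩

end

variable {E : Type*} [NormedAddCommGroup E] [NormedSpace ℝ E]
  {M : Type*} [TopologicalSpace M] [ChartedSpace E M] [IsManifold 𝓘(ℝ, E) ∞ M]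

/-! ### The difference tensor of two connections and its effect on `J^∇`. -/

section comparison
variable [FiniteDimensional ℝ E]

/-- The difference of two connections at a point, as a bilinear map. -/
noncomputable def connectionDiff (cov cov' : Connection E M) (x : M) : E →ₗ[ℝ] E →ₗ[ℝ] E :=
  LinearMap.mk₂ ℝ (fun u v => christoffel cov' x u v - christoffel cov x u v)
    (fun u u' v => by
      have h1 : christoffel cov x (u + u') v = christoffel cov x u v + christoffel cov x u' v :=
        congrArg (fun f : E →L[ℝ] E => f v) (christoffelEnd_add cov x u u')
      have h2 : christoffel cov' x (u + u') v = christoffel cov' x u v + christoffel cov' x u' v :=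
        congrArg (fun f : E →L[ℝ] E => f v) (christoffelEnd_add cov' x u u')
      rw [h1, h2]; abel)
    (fun c u v => by
      have h1 : christoffel cov x (c • u) v = c • christoffel cov x u v :=
        congrArg (fun f : E →L[ℝ] E => f v) (christoffelEnd_smul cov x c u)
      have h2 : christoffel cov' x (c • u) v = c • christoffel cov' x u v :=
        congrArg (fun f : E →L[ℝ] E => f v) (christoffelEnd_smul cov' x c u)
      rw [h1, h2, smul_sub])
    (fun u v v' => by
      rw [christoffel_add_right, christoffel_add_right]; abel)
    (fun c u v => by
      rw [christoffel_smul_right, christoffel_smul_right, smul_sub])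

lemma connectionDiff_apply (cov cov' : Connection E M) (x : M) (u v : E) :
    connectionDiff cov cov' x u v = christoffel cov' x u v - christoffel cov x u v := rfl

/-- In the local formula for a connection the derivative term depends on the section alone, so only
the zeroth-order terms differ. -/
lemma cov_eq_add_connectionDiff (cov cov' : Connection E M) (x : M)
    {s : Π x : M, TangentSpace 𝓘(ℝ, E) x}
    (hs : MDifferentiableAt 𝓘(ℝ, E) (𝓘(ℝ, E).prod 𝓘(ℝ, E))
      (fun y => (⟨y, s y⟩ : TotalSpace E (TangentSpace 𝓘(ℝ, E)))) x) (u : E) :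
    (cov' s x u : E) = HAdd.hAdd (α := E) (cov s x u) (connectionDiff cov cov' x u (s x)) := by
  refine (cov_eq_local cov' x s hs u).trans
    (Eq.trans ?_ (congrArg (fun w : E => w + _) (cov_eq_local cov x s hs u)).symm)
  refine Eq.trans ?_ (add_assoc (G := E) _ _ _).symm
  exact congrArg₂ (HAdd.hAdd : E → E → E) rfl (add_sub_cancel (G := E) _ _).symm

/-- The coordinate vertical part of `X` enters both sides equally; what remains is the commutator of
the difference tensor with `p`. -/
lemma nablaTaut_eq_add_connectionDiff (cov cov' : Connection E M) (p : EndBundle E M)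
    (X : E × (E →L[ℝ] E)) (v : E) :
    (nablaTaut cov' p X v : E) = HAdd.hAdd (α := E) (nablaTaut cov p X v)
      (connectionDiff cov cov' p.1 X.1 (endo p v) -
        endo p (connectionDiff cov cov' p.1 X.1 v)) := by
  obtain ⟨u, B⟩ := X
  refine (nablaTaut_apply cov' p u B v).trans
    (Eq.trans ?_ (congrArg (fun w : E => w + _) (nablaTaut_apply cov p u B v)).symm)
  simp only [connectionDiff_apply, map_sub]
  abel

/-- `J^∇ = J^∇'` at a point `p` iff the difference tensor `D` satisfies `[D_{p u}, p] = p [D_u, p]`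
for all `u`. -/
theorem twistorStructure_eq_iff (cov cov' : Connection E M) (p : twistorSpace E M) :
    twistorStructure cov p = twistorStructure cov' p ↔
      ∀ u v : E, connectionDiff cov cov' p.1.1 (endo p.1 u) (endo p.1 v) -
          endo p.1 (connectionDiff cov cov' p.1.1 (endo p.1 u) v) =
        endo p.1 (connectionDiff cov cov' p.1.1 u (endo p.1 v) -
          endo p.1 (connectionDiff cov cov' p.1.1 u v)) := by
  have := FiniteDimensional.complete ℝ E
  -- The base component of `J X` is `p` applied to that of `X`. This puts `p u` into the first slot
  -- of the difference tensor along `J X`.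
  have hproj : ∀ X : twistorTangent p,
      (show E × (E →L[ℝ] E) from (twistorStructure cov p X).1).1 =
        endo p.1 (show E × (E →L[ℝ] E) from X.1).1 := by
    rintro ⟨⟨u, B⟩, hX⟩
    have h := (twistorStructure_spec cov p).proj ⟨⟨u, B⟩, hX⟩
    exact (mfderiv_proj_apply p.1 _ _).symm.trans
      (h.trans (congrArg (endo p.1) (mfderiv_proj_apply p.1 u B)))
  constructor
  · intro h u v
    -- A tangent vector of `J(M)` over `u` is needed; the zero vertical coordinate anticommutes with
    -- `p`, so this lift is tangent.
    have hX : IsTangent p.1 (u, (0 : E →L[ℝ] E)) :=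
      isTangent_of_anticomm p.2 u 0 (by simp)
    let X : twistorTangent p := ⟨(u, (0 : E →L[ℝ] E)), hX⟩
    have h1 := (twistorStructure_spec cov p).nabla X v
    have h2 := (twistorStructure_spec cov' p).nabla X v
    rw [← h] at h2
    have h3 := nablaTaut_eq_add_connectionDiff cov cov' p.1 (twistorStructure cov p X).1 v
    have h4 := congrArg (endo p.1) (nablaTaut_eq_add_connectionDiff cov cov' p.1 X.1 v)
    rw [hproj X] at h3
    have h5 := h3.symm.trans (h2.trans h4)
    have h6 := h5.trans (map_add (endo p.1) _ _)
    exact add_left_cancel (G := E) (h6.trans (congrArg (fun w : E => w + _) h1.symm))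
  · intro h
    -- By uniqueness it suffices that `J^∇` satisfies the equations defining `J^∇'`. The projection
    -- equation does not involve the connection.
    refine (existsUnique_twistorStructure cov' p).unique
      ⟨(twistorStructure_spec cov p).proj, fun X v => ?_⟩ (twistorStructure_spec cov' p)
    have h1 := (twistorStructure_spec cov p).nabla X v
    have h3 := nablaTaut_eq_add_connectionDiff cov cov' p.1 (twistorStructure cov p X).1 v
    have h4 := congrArg (endo p.1) (nablaTaut_eq_add_connectionDiff cov cov' p.1 X.1 v)
    rw [hproj X] at h3
    refine h3.trans (Eq.trans ?_ (h4.trans (map_add (endo p.1) _ _)).symm)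
    exact congrArg₂ (fun a b : E => a + b) h1 (h _ _)

/-- Testing the equivalence on fields with constant coordinates gives `D u v = β u • v + β v • u`.
The terms with `β u` commute with `p`, and the others satisfy the criterion by `p² = -1`. -/
lemma twistorStructure_eq_of_projectivelyEquivalent {cov cov' : Connection E M}
    (h : ProjectivelyEquivalent cov cov') : twistorStructure cov = twistorStructure cov' := by
  obtain ⟨α, -, hα⟩ := h
  funext p
  let β : E →L[ℝ] ℝ := α p.1.1
  have hD : ∀ u v : E, connectionDiff cov cov' p.1.1 u v = β u • v + β v • u := by
    intro u v
    have h1 := hα p.1.1 (extend E (x := p.1.1) (E := TangentSpace 𝓘(ℝ, E)) v)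
      (mdiff_extend p.1.1 v) u
    have e0 : extend E (x := p.1.1) (E := TangentSpace 𝓘(ℝ, E)) v p.1.1 = v :=
      extend_apply_self ..
    rw [e0] at h1
    have h2 : christoffel cov' p.1.1 u v =
      christoffel cov p.1.1 u v + β u • v + β v • u := h1
    rw [connectionDiff_apply, h2]
    abel
  rw [twistorStructure_eq_iff]
  intro u v
  have ha : ∀ v : E, endo p.1 (endo p.1 v) = -v := fun v =>
    congrArg (fun f : E →L[ℝ] E => f v) (endo_sq p.2)
  simp only [hD, map_add, map_smul, map_sub, ha]
  module

/-- For torsion-free connections the difference tensor is symmetric. -/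
lemma connectionDiff_symm {cov cov' : Connection E M} (h : IsTorsionFree cov)
    (h' : IsTorsionFree cov') (x : M) (u v : E) :
    connectionDiff cov cov' x u v = connectionDiff cov cov' x v u := by
  have := FiniteDimensional.complete ℝ E
  -- The antisymmetric part equals a Lie bracket that is independent of the connection, so it drops
  -- out of the difference.
  have key : ∀ {c : Connection E M}, IsTorsionFree c →
      christoffel c x u v - christoffel c x v u =
        (VectorField.mlieBracket 𝓘(ℝ, E) (extend E (x := x) (E := TangentSpace 𝓘(ℝ, E)) u)
          (extend E (x := x) (E := TangentSpace 𝓘(ℝ, E)) v) x : E) := by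
    intro c hc
    have h1 := (CovariantDerivative.torsion_eq_zero_iff c).1 hc (mdiff_extend x u)
      (mdiff_extend x v)
    have e0 : ∀ w : E, extend E (x := x) (E := TangentSpace 𝓘(ℝ, E)) w x = w :=
      fun w => extend_apply_self ..
    rw [e0, e0] at h1
    exact h1
  have h1 := (key h').trans (key h).symm
  rw [connectionDiff_apply, connectionDiff_apply]
  linear_combination (norm := module) (1 : ℝ) • h1

/-- If `J^∇ = J^∇'` and the difference tensor is symmetric, then it is of the form
`α(u) v + α(v) u`. -/
lemma exists_form_of_twistorStructure_eq (hE : Even (Module.finrank ℝ E))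
    {cov cov' : Connection E M} (h : IsTorsionFree cov) (h' : IsTorsionFree cov')
    (hJ : twistorStructure cov = twistorStructure cov') (x : M) :
    ∃ α : E →L[ℝ] ℝ, ∀ u v : E, connectionDiff cov cov' x u v = α u • v + α v • u := by
  -- Every complex structure on the tangent space at `x` is a point of `J(M)` over `x`, so `hJ`
  -- supplies the criterion for all of them.
  obtain ⟨α, hα⟩ := exists_linear_of_forall_complexStructure hE (connectionDiff_symm h h' x)
    fun a ha u v => by
      let a' : E →L[ℝ] E := LinearMap.toContinuousLinearMap a
      let p : twistorSpace E M := ⟨⟨x, a'⟩, ContinuousLinearMap.ext fun v => ha v⟩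
      exact (twistorStructure_eq_iff cov cov' p).1 (congrFun hJ p) u v
  exact ⟨LinearMap.toContinuousLinearMap α, hα⟩

end comparison

/-! ### Smoothness of the one-form. -/

section smoothness
variable [FiniteDimensional ℝ E] [T2Space M]

/-- A vector field that is smooth on `M` and has constant coordinates near `x`. -/
lemma exists_contMDiff_eventuallyEq_symmL (x : M) (v : E) :
    ∃ s : Π y : M, TangentSpace 𝓘(ℝ, E) y,
      ContMDiff 𝓘(ℝ, E) (𝓘(ℝ, E).prod 𝓘(ℝ, E)) ∞
        (fun y => (⟨y, s y⟩ : TotalSpace E (TangentSpace 𝓘(ℝ, E)))) ∧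
      ∀ᶠ y in 𝓝 x, s y = (trivializationAt E (TangentSpace 𝓘(ℝ, E)) x).symmL ℝ y v := by
  let χ : SmoothBumpFunction 𝓘(ℝ, E) x := Classical.arbitrary _
  let s₀ : Π y : M, TangentSpace 𝓘(ℝ, E) y := fun y =>
    (trivializationAt E (TangentSpace 𝓘(ℝ, E)) x).symmL ℝ y v
  refine ⟨(χ : M → ℝ) • s₀, ?_, ?_⟩
  -- The closed support of the bump function lies in the chart domain, where the field has constant
  -- coordinates; outside it the product is zero.
  · refine ContMDiffOn.smul_section_of_tsupport χ.contMDiff.contMDiffOn (chartAt E x).open_source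
      χ.tsupport_subset_chartAt_source ?_
    intro y hy
    refine ((trivializationAt E (TangentSpace 𝓘(ℝ, E)) x).contMDiffWithinAt_section _ hy).2 ?_
    refine (contMDiffWithinAt_const (c := v)).congr (fun z hz => ?_) ?_
    · exact (triv_eq z hz _).trans (clmAt_symmL hz v)
    · exact (triv_eq y hy _).trans (clmAt_symmL hy v)
  · filter_upwards [χ.eventuallyEq_one] with y hy
    rw [Pi.smul_apply', hy, Pi.one_apply, one_smul]

/-- A `1`-form is smooth at `x` if its values on the vector fields with constant coordinates are. -/
lemma contMDiffAt_form_of_forall {α : Π y : M, TangentSpace 𝓘(ℝ, E) y →L[ℝ] ℝ} {x : M}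
    (h : ∀ v : E, ContMDiffAt 𝓘(ℝ, E) 𝓘(ℝ, ℝ) ∞ (fun y =>
      α y ((trivializationAt E (TangentSpace 𝓘(ℝ, E)) x).symmL ℝ y v)) x) :
    ContMDiffAt 𝓘(ℝ, E) (𝓘(ℝ, E).prod 𝓘(ℝ, E →L[ℝ] ℝ)) ∞
      (fun x => TotalSpace.mk' (E →L[ℝ] ℝ)
        (E := fun x : M => TangentSpace 𝓘(ℝ, E) x →L[ℝ] Trivial M ℝ x) x (α x)) x := by
  rw [contMDiffAt_section]
  let L : M → E →L[ℝ] ℝ := fun y =>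
    (α y).comp ((trivializationAt E (TangentSpace 𝓘(ℝ, E)) x).symmL ℝ y)
  have hL : ContMDiffAt 𝓘(ℝ, E) 𝓘(ℝ, E →L[ℝ] ℝ) ∞ L x := by
    let b := Module.finBasis ℝ E
    -- Expanding in the dual basis reduces smoothness of an operator-valued map to that of finitely
    -- many scalar functions.
    have h1 : L = fun y => ∑ i, L y (b i) • LinearMap.toContinuousLinearMap (b.coord i) := by
      funext y
      refine ContinuousLinearMap.ext fun w => ?_
      conv_lhs => rw [← b.sum_repr w, map_sum]
      simp [mul_comm]
    rw [h1]
    exact contMDiffAt_finsetSum fun i _ => (h (b i)).smul contMDiffAt_const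
  refine hL.congr_of_eventuallyEq (Filter.Eventually.of_forall fun y => ?_)
  refine ContinuousLinearMap.ext fun w => ?_
  simp only [hom_trivializationAt_apply, ContinuousLinearMap.inCoordinates]
  simp [L]

/-- Smoothness of a connection is applied here to globally smooth fields, which is why local
constant-coordinate fields are first cut off. -/
lemma contMDiffAt_cov_apply {cov : Connection E M}
    (hcov : CovariantDerivative.ContMDiffCovariantDerivative cov ∞)
    {s : Π y : M, TangentSpace 𝓘(ℝ, E) y}
    (hs : ContMDiff 𝓘(ℝ, E) (𝓘(ℝ, E).prod 𝓘(ℝ, E)) ∞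
      (fun y => (⟨y, s y⟩ : TotalSpace E (TangentSpace 𝓘(ℝ, E))))) (x : M) :
    ContMDiffAt 𝓘(ℝ, E) 𝓘(ℝ, E) ∞ (fun y =>
      (trivializationAt E (TangentSpace 𝓘(ℝ, E)) x ⟨y, cov s y (s y)⟩).2) x := by
  have h1 := contMDiffOn_univ.1 (hcov.contMDiff.contMDiff (σ := s) (by simpa [contMDiffOn_univ] using hs))
  exact (contMDiffAt_section x).1 (ContMDiffAt.clm_bundle_apply (h1 x) (hs x))

/-- On a field `s` one has `∇'_s s - ∇_s s = 2 α(s) s`. If `s` has constant coordinates `v ≠ 0` near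
`x` and `f v = 1`, applying `f / 2` in the trivialization gives `α(s)` as a smooth function. -/
lemma contMDiff_of_connectionDiff_eq {cov cov' : Connection E M}
    (hcov : CovariantDerivative.ContMDiffCovariantDerivative cov ∞)
    (hcov' : CovariantDerivative.ContMDiffCovariantDerivative cov' ∞)
    {α : Π y : M, TangentSpace 𝓘(ℝ, E) y →L[ℝ] ℝ}
    (hα : ∀ (x : M) (u v : E), connectionDiff cov cov' x u v =
      (show E →L[ℝ] ℝ from α x) u • v + (show E →L[ℝ] ℝ from α x) v • u) :
    ContMDiff 𝓘(ℝ, E) (𝓘(ℝ, E).prod 𝓘(ℝ, E →L[ℝ] ℝ)) ∞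
      (fun x => TotalSpace.mk' (E →L[ℝ] ℝ)
        (E := fun x : M => TangentSpace 𝓘(ℝ, E) x →L[ℝ] Trivial M ℝ x) x (α x)) := by
  intro x
  refine contMDiffAt_form_of_forall fun v => ?_
  -- No functional takes the value `1` at `v = 0`, so that case is separate.
  rcases eq_or_ne v 0 with rfl | hv
  · simp only [map_zero]
    exact contMDiffAt_const
  obtain ⟨f, hf⟩ := SeparatingDual.exists_eq_one (R := ℝ) hv
  obtain ⟨s, hs, hsv⟩ := exists_contMDiff_eventuallyEq_symmL x v
  have h1 := (contMDiffAt_cov_apply hcov' hs x).sub (contMDiffAt_cov_apply hcov hs x)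
  have h2 := (((2⁻¹ : ℝ) • f).contDiff (n := ∞)).contMDiff.contMDiffAt.comp x h1
  refine h2.congr_of_eventuallyEq ?_
  filter_upwards [hsv, (chartAt E x).open_source.mem_nhds (mem_chart_source E x)] with y hy hyx
  let T : E →L[ℝ] E := (trivializationAt E (TangentSpace 𝓘(ℝ, E)) x).continuousLinearMapAt ℝ y
  let w : E := s y
  let β : E →L[ℝ] ℝ := α y
  have e1 : (cov' s y (s y) : E) = HAdd.hAdd (α := E) (cov s y (s y)) (β w • w + β w • w) :=
    (cov_eq_add_connectionDiff cov cov' y (hs.mdifferentiableAt (by simp)) (s y)).trans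
      (congrArg (fun z : E => HAdd.hAdd (α := E) (cov s y (s y)) z) (hα y w w))
  have e2 : T w = v := (congrArg T hy).trans (clmAt_symmL hyx v)
  have e3 : HSub.hSub (α := E)
      (trivializationAt E (TangentSpace 𝓘(ℝ, E)) x ⟨y, cov' s y (s y)⟩).2
      (trivializationAt E (TangentSpace 𝓘(ℝ, E)) x ⟨y, cov s y (s y)⟩).2 = (2 * β w) • v := by
    refine (congrArg₂ (fun a b : E => a - b) (triv_eq y hyx _) (triv_eq y hyx _)).trans ?_
    refine (congrArg (fun z : E => T z - T (cov s y (s y))) e1).trans ?_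
    refine (congrArg (fun z : E => z - T (cov s y (s y))) (map_add T _ _)).trans ?_
    refine (add_sub_cancel_left (G := E) _ _).trans ?_
    rw [map_add, map_smul, e2]
    module
  have e4 : β w = ((2⁻¹ : ℝ) • f) ((2 * β w) • v) := by
    simp only [_root_.smul_apply, map_smul, hf, smul_eq_mul]
    ring
  exact (congrArg β hy.symm).trans (e4.trans (congrArg ((2⁻¹ : ℝ) • f) e3.symm))

/-- The forms are chosen independently at each point; the identity they satisfy with the difference
tensor then forces the family to be smooth. -/
lemma projectivelyEquivalent_of_twistorStructure_eq (hE : Even (Module.finrank ℝ E))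
    {cov cov' : Connection E M}
    (hcov : CovariantDerivative.ContMDiffCovariantDerivative cov ∞)
    (hcov' : CovariantDerivative.ContMDiffCovariantDerivative cov' ∞)
    (h : IsTorsionFree cov) (h' : IsTorsionFree cov')
    (hJ : twistorStructure cov = twistorStructure cov') : ProjectivelyEquivalent cov cov' := by
  choose α hα using exists_form_of_twistorStructure_eq hE h h' hJ
  refine ⟨α, contMDiff_of_connectionDiff_eq hcov hcov' hα, fun x Y hY X => ?_⟩
  refine (cov_eq_add_connectionDiff cov cov' x hY X).trans ?_
  refine (congrArg (fun z : E => HAdd.hAdd (α := E) (cov Y x X) z) (hα x X (Y x))).trans ?_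
  exact (add_assoc (G := E) _ _ _).symm

end smoothness

end Twistor

theorem mainTheorem3
    {E : Type*} [NormedAddCommGroup E] [NormedSpace ℝ E] [FiniteDimensional ℝ E]
    (hE : Even (Module.finrank ℝ E))
    {M : Type*} [TopologicalSpace M] [T2Space M] [ChartedSpace E M]
    [IsManifold 𝓘(ℝ, E) ∞ M]
    (cov cov' : Twistor.Connection E M)
    (hcov : CovariantDerivative.ContMDiffCovariantDerivative cov ∞)
    (hcov' : CovariantDerivative.ContMDiffCovariantDerivative cov' ∞) :
    (Twistor.ProjectivelyEquivalent cov cov' →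
      Twistor.twistorStructure cov = Twistor.twistorStructure cov') ∧
    (Twistor.IsTorsionFree cov → Twistor.IsTorsionFree cov' →
      (Twistor.twistorStructure cov = Twistor.twistorStructure cov' ↔
        Twistor.ProjectivelyEquivalent cov cov')) :=
  ⟨Twistor.twistorStructure_eq_of_projectivelyEquivalent, fun h h' =>
    ⟨Twistor.projectivelyEquivalent_of_twistorStructure_eq hE hcov hcov' h h',
      Twistor.twistorStructure_eq_of_projectivelyEquivalent⟩⟩
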